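/- Call a finite sequence $a_1,\dots,a_n$ ($n\ge 0$) of elements of a group $G$ an \emph{Ordered Generating System} of $G$ if there are integers $m_1,\dots,m_n\ge 0$ such that every $g\in G$ can be written in exactly one way as $g=a_1^{i_1}a_2^{i_2}\cdots a_n^{i_n}$ with integers $0\le i_k\le m_k$ for $1\le k\le n$. \textbf{Theorem 1.} Let $G$ be a finite group, and suppose that each composition factor of $G$ (that is, each quotient $G_i/G_{i+1}$ of a composition series $G=G_0>G_1>\cdots>G_l=\{1\}$) is cyclic, or isomorphic to an alternating group $A_n$ for some $n$, or isomorphic to $\mathrm{PSL}_n(q)$ for some $n$ and some prime power $q$; different factors may be of different kinds and have different parameters. Then $G$ has an Ordered Generating System. -/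

import Mathlib

/-- A finite sequence `a` of elements of a group `G` is an *ordered generating system* of `G` if
there are bounds `m k` such that every element of `G` has a unique representation
`a 0 ^ i 0 * a 1 ^ i 1 * ⋯ * a (n - 1) ^ i (n - 1)` (product in this order)
with exponents `0 ≤ i k ≤ m k`. -/
def IsOrderedGeneratingSystem {G : Type*} [Group G] {n : ℕ} (a : Fin n → G) : Prop :=
  ∃ m : Fin n → ℕ, ∀ g : G, ∃! i : Fin n → ℕ,
    (∀ k, i k ≤ m k) ∧ g = (List.ofFn fun k => a k ^ i k).prod

/-- A group has an ordered generating system. -/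
def HasOrderedGeneratingSystem (G : Type*) [Group G] : Prop :=
  ∃ (n : ℕ) (a : Fin n → G), IsOrderedGeneratingSystem a

/-- A composition series `G = G₀ > G₁ > ⋯ > Gₗ = 1` of a group `G`: each term is a normal subgroup
of the preceding one, with simple (in particular nontrivial) quotient. -/
structure GroupCompositionSeries (G : Type*) [Group G] where
  /-- The length of the series. -/
  length : ℕ
  /-- The terms of the series. -/
  term : Fin (length + 1) → Subgroup G
  term_zero : term 0 = ⊤
  term_last : term (Fin.last length) = ⊥
  le : ∀ i : Fin length, term i.succ ≤ term i.castSucc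
  normal : ∀ i : Fin length, ((term i.succ).subgroupOf (term i.castSucc)).Normal
  simple : ∀ i : Fin length,
    IsSimpleGroup (↥(term i.castSucc) ⧸ (term i.succ).subgroupOf (term i.castSucc))

attribute [instance] GroupCompositionSeries.normal

/-- The composition factor `G_i / G_{i+1}` of a composition series. -/
abbrev GroupCompositionSeries.Factor {G : Type*} [Group G] (s : GroupCompositionSeries G)
    (i : Fin s.length) : Type _ :=
  ↥(s.term i.castSucc) ⧸ (s.term i.succ).subgroupOf (s.term i.castSucc)

/-- The group `S` is cyclic, or isomorphic to an alternating group `A_n`, or isomorphic to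
`PSL_n(q) = PSL_n(F)` for a finite field `F` (with `q` elements). -/
def IsCyclicOrAlternatingOrPSL (S : Type*) [Group S] : Prop :=
  IsCyclic S ∨
  (∃ n : ℕ, Nonempty (S ≃* alternatingGroup (Fin n))) ∨
  (∃ (n : ℕ) (F : Type) (_ : Field F) (_ : Finite F),
    Nonempty (S ≃* Matrix.ProjectiveSpecialLinearGroup (Fin n) F))

/-! Unique factorizations multiply along a chain of subgroups: if `A` is a left transversal of `H`
in `K` and `B` one of `L` in `H`, then `A * B` is one of `L` in `K`. They also lift through
surjections, generator by generator. Hence it suffices to factor every composition factor.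

Finite abelian groups split off one cyclic subgroup at a time. For alternating groups, remove points
one by one: coset representatives of a point stabilizer are the powers of a full cycle if the number
of points is odd, and otherwise come from two equal cycles and a 3-cycle exchanging the halves.

For `SL_{m+1}(F)`, the stabilizer of a line reduces to the center through two abelian quotients and
`SL_m(F)`, which allows induction. To reach each line exactly once
(`hasCyclicTransversal_lineStabilizer`), identify `F^(m+1)` with the field extension `K` of degree
`m + 1`. Multiplication by a generator `s` of the norm-one group has determinant 1, and its orbits
on lines are the cosets of `H`, the units whose norm is an `(m+1)`-th power. There are at most `m +
1` of them, and `H` is so large that coset representatives can be part of a basis; a signed cyclic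
permutation matrix then moves from orbit to orbit. -/

/-- A subset of a group is a *cyclic product* if it is a direct product (in the sense that
factorizations are unique) of finitely many sets of the form `{1, a, …, a ^ m}`. -/
inductive IsCyclicProduct {G : Type*} [Group G] : Set G → Prop
  | one : IsCyclicProduct {1}
  | mul (a : G) (m : ℕ) {A : Set G} (hA : IsCyclicProduct A)
      (inj : ∀ i ≤ m, ∀ j ≤ m, ∀ x ∈ A, ∀ y ∈ A, a ^ i * x = a ^ j * y → i = j ∧ x = y) :
      IsCyclicProduct {g | ∃ i ≤ m, ∃ x ∈ A, g = a ^ i * x}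

/-! ### Products, lifts and images of cyclic products -/

namespace IsCyclicProduct

variable {G Q : Type*} [Group G] [Group Q]

theorem exists_tuple {A : Set G} (hA : IsCyclicProduct A) :
    ∃ (n : ℕ) (a : Fin n → G) (m : Fin n → ℕ),
      (∀ i : Fin n → ℕ, (∀ k, i k ≤ m k) → (List.ofFn fun k => a k ^ i k).prod ∈ A) ∧
      ∀ g ∈ A, ∃! i : Fin n → ℕ, (∀ k, i k ≤ m k) ∧ g = (List.ofFn fun k => a k ^ i k).prod := by
  induction hA with
  | one =>
    refine ⟨0, Fin.elim0, Fin.elim0, by simp, ?_⟩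
    rintro g rfl
    exact ⟨Fin.elim0, by simp, fun _ _ => Subsingleton.elim _ _⟩
  | @mul b l A hA inj ih =>
    obtain ⟨n, a, m, hmem, huniq⟩ := ih
    refine ⟨n + 1, Fin.cons b a, Fin.cons l m, fun i hi => ?_, ?_⟩
    · rw [List.ofFn_succ, List.prod_cons]
      exact ⟨i 0, hi 0, _, hmem (fun k => i k.succ) (fun k => hi k.succ), by simp⟩
    · rintro _ ⟨i, hi, x, hx, rfl⟩
      obtain ⟨t, ⟨ht, rfl⟩, htu⟩ := huniq x hx
      refine ⟨Fin.cons i t, ⟨fun k => ?_, by simp [List.ofFn_succ]⟩, ?_⟩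
      · cases k using Fin.cases with
        | zero => simpa using hi
        | succ k => simpa using ht k
      · rintro u ⟨hu, hprod⟩
        rw [List.ofFn_succ, List.prod_cons] at hprod
        simp only [Fin.cons_zero, Fin.cons_succ] at hprod
        obtain ⟨h0, h1⟩ := inj i hi (u 0) (hu 0) _ (hmem t ht) _
          (hmem (fun k => u k.succ) fun k => hu k.succ) hprod
        have h2 := htu (fun k => u k.succ) ⟨fun k => hu k.succ, h1⟩
        rw [← Fin.cons_self_tail u, h0, ← h2]
        rfl

theorem hasOrderedGeneratingSystem (h : IsCyclicProduct (Set.univ : Set G)) :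
    HasOrderedGeneratingSystem G := by
  obtain ⟨n, a, m, -, h⟩ := h.exists_tuple
  exact ⟨n, a, m, fun g => h g trivial⟩

theorem mul_set {A B : Set G} (hA : IsCyclicProduct A) (hB : IsCyclicProduct B)
    (inj : ∀ x ∈ A, ∀ x' ∈ A, ∀ y ∈ B, ∀ y' ∈ B, x * y = x' * y' → x = x' ∧ y = y') :
    IsCyclicProduct {g | ∃ x ∈ A, ∃ y ∈ B, g = x * y} := by
  induction hA with
  | one => simpa using hB
  | @mul a m A hA hinj ih =>
    have key : ∀ i ≤ m, ∀ x ∈ A, ∀ i' ≤ m, ∀ x' ∈ A, ∀ y ∈ B, ∀ y' ∈ B,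
        a ^ i * x * y = a ^ i' * x' * y' → i = i' ∧ x = x' ∧ y = y' := by
      intro i hi x hx i' hi' x' hx' y hy y' hy' h
      obtain ⟨h1, h2⟩ := inj _ ⟨i, hi, x, hx, rfl⟩ _ ⟨i', hi', x', hx', rfl⟩ y hy y' hy' h
      obtain ⟨h3, h4⟩ := hinj i hi i' hi' x hx x' hx' h1
      exact ⟨h3, h4, h2⟩
    have := IsCyclicProduct.mul a m (ih fun x hx x' hx' y hy y' hy' h =>
      (key 0 (Nat.zero_le _) x hx 0 (Nat.zero_le _) x' hx' y hy y' hy' (by simpa using h)).2) ?_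
    · convert this using 1
      ext g
      constructor
      · rintro ⟨_, ⟨i, hi, x, hx, rfl⟩, y, hy, rfl⟩
        exact ⟨i, hi, _, ⟨x, hx, y, hy, rfl⟩, mul_assoc _ _ _⟩
      · rintro ⟨i, hi, _, ⟨x, hx, y, hy, rfl⟩, rfl⟩
        exact ⟨_, ⟨i, hi, x, hx, rfl⟩, y, hy, (mul_assoc _ _ _).symm⟩
    · rintro i hi j hj _ ⟨x, hx, y, hy, rfl⟩ _ ⟨x', hx', y', hy', rfl⟩ h
      obtain ⟨h1, rfl, rfl⟩ := key i hi x hx j hj x' hx' y hy y' hy' (by simpa [mul_assoc] using h)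
      exact ⟨h1, rfl⟩

theorem powers (a : G) (m : ℕ) (inj : ∀ i ≤ m, ∀ j ≤ m, a ^ i = a ^ j → i = j) :
    IsCyclicProduct {g | ∃ i ≤ m, g = a ^ i} := by
  simpa using IsCyclicProduct.mul a m IsCyclicProduct.one
    (by rintro i hi j hj x rfl y rfl h; exact ⟨inj i hi j hj (by simpa using h), rfl⟩)

theorem exists_lift {f : G →* Q} (hf : Function.Surjective f) {A : Set Q}
    (hA : IsCyclicProduct A) :
    ∃ B : Set G, IsCyclicProduct B ∧ (∀ b ∈ B, f b ∈ A) ∧ ∀ a ∈ A, ∃! b, b ∈ B ∧ f b = a := by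
  induction hA with
  | one =>
    refine ⟨{1}, .one, by simp, ?_⟩
    rintro _ rfl
    exact ⟨1, by simp, by simp⟩
  | @mul a m A hA inj ih =>
    obtain ⟨B, hB, hBA, hAB⟩ := ih
    obtain ⟨c, rfl⟩ := hf a
    have key : ∀ i ≤ m, ∀ j ≤ m, ∀ x ∈ B, ∀ y ∈ B, f (c ^ i * x) = f (c ^ j * y) →
        i = j ∧ x = y := by
      intro i hi j hj x hx y hy h
      obtain ⟨h1, h2⟩ := inj i hi j hj _ (hBA x hx) _ (hBA y hy) (by simpa using h)
      exact ⟨h1, (hAB _ (hBA y hy)).unique ⟨hx, h2⟩ ⟨hy, rfl⟩⟩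
    refine ⟨_, .mul c m hB fun i hi j hj x hx y hy h => key i hi j hj x hx y hy (by rw [h]), ?_, ?_⟩
    · rintro _ ⟨i, hi, x, hx, rfl⟩
      exact ⟨i, hi, f x, hBA x hx, by simp⟩
    · rintro _ ⟨i, hi, x, hx, rfl⟩
      obtain ⟨b, ⟨hb, rfl⟩, -⟩ := hAB x hx
      refine ⟨c ^ i * b, ⟨⟨i, hi, b, hb, rfl⟩, by simp⟩, ?_⟩
      rintro _ ⟨⟨j, hj, y, hy, rfl⟩, h⟩
      obtain ⟨rfl, rfl⟩ := key i hi j hj b hb y hy (by rw [h]; simp)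
      rfl

theorem image {f : G →* Q} {A : Set G} (hA : IsCyclicProduct A) (hf : Set.InjOn f A) :
    IsCyclicProduct (f '' A) := by
  induction hA with
  | one => simpa using IsCyclicProduct.one
  | @mul a m A hA inj ih =>
    have key : ∀ i ≤ m, ∀ j ≤ m, ∀ x ∈ A, ∀ y ∈ A, f (a ^ i * x) = f (a ^ j * y) →
        i = j ∧ x = y := fun i hi j hj x hx y hy h =>
      inj i hi j hj x hx y hy (hf ⟨i, hi, x, hx, rfl⟩ ⟨j, hj, y, hy, rfl⟩ h)
    have := IsCyclicProduct.mul (f a) m (ih fun x hx y hy h =>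
      (key 0 (Nat.zero_le _) 0 (Nat.zero_le _) x hx y hy (by simpa using h)).2) ?_
    · convert this using 1
      ext q
      constructor
      · rintro ⟨_, ⟨i, hi, x, hx, rfl⟩, rfl⟩
        exact ⟨i, hi, f x, ⟨x, hx, rfl⟩, by simp⟩
      · rintro ⟨i, hi, _, ⟨x, hx, rfl⟩, rfl⟩
        exact ⟨_, ⟨i, hi, x, hx, rfl⟩, by simp⟩
    · rintro i hi j hj _ ⟨x, hx, rfl⟩ _ ⟨y, hy, rfl⟩ h
      obtain ⟨h1, rfl⟩ := key i hi j hj x hx y hy (by simpa using h)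
      exact ⟨h1, rfl⟩

theorem nonempty {A : Set G} (hA : IsCyclicProduct A) : A.Nonempty := by
  induction hA with
  | one => exact Set.singleton_nonempty 1
  | @mul a m A hA inj ih =>
    obtain ⟨x, hx⟩ := ih
    exact ⟨a ^ 0 * x, 0, Nat.zero_le _, x, hx, rfl⟩

theorem preimage_subtype {K : Subgroup G} {A : Set G} (hA : IsCyclicProduct A)
    (hAK : A ⊆ K) : IsCyclicProduct (K.subtype ⁻¹' A) := by
  induction hA with
  | one =>
    convert! IsCyclicProduct.one (G := K)
    ext x
    simp
  | @mul a m A hA inj ih =>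
    have hAK' : A ⊆ K := fun x hx => hAK ⟨0, Nat.zero_le _, x, hx, by simp⟩
    -- For `m = 0` the generator never occurs and may lie outside `K`; otherwise `x` and `a * x` in
    -- `K` force `a` into `K`.
    rcases Nat.eq_zero_or_pos m with rfl | hm
    · simpa using ih hAK'
    · obtain ⟨x, hx⟩ := hA.nonempty
      have ha : a ∈ K := by
        have h : a * x ∈ K := hAK ⟨1, hm, x, hx, by simp⟩
        exact (mul_mem_cancel_right (hAK' hx)).1 h
      refine (congrArg IsCyclicProduct ?_).mp
        (IsCyclicProduct.mul ⟨a, ha⟩ m (ih hAK') fun i hi j hj x hx y hy h => ?_)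
      · ext g
        constructor
        · rintro ⟨i, hi, x, hx, rfl⟩
          exact ⟨i, hi, x, hx, rfl⟩
        · rintro ⟨i, hi, x, hx, h⟩
          exact ⟨i, hi, ⟨x, hAK' hx⟩, hx, Subtype.ext h⟩
      · obtain ⟨h1, h2⟩ := inj i hi j hj x hx y hy (congrArg Subtype.val h)
        exact ⟨h1, Subtype.ext h2⟩

end IsCyclicProduct

/-! ### Cyclic transversals and chains of subgroups -/

/-- The subgroup `K` is the direct product (as a set) of a cyclic product contained in `K`
and of the subgroup `H`; for `H ≤ K`, this says that some cyclic product is a left transversal of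
`H` in `K`. -/
def HasCyclicTransversal {G : Type*} [Group G] (H K : Subgroup G) : Prop :=
  ∃ A : Set G, IsCyclicProduct A ∧ A ⊆ K ∧ ∀ g ∈ K, ∃! a, a ∈ A ∧ a⁻¹ * g ∈ H

/-- The whole group is a cyclic product. -/
def IsCyclicallyFactored (G : Type*) [Group G] : Prop :=
  IsCyclicProduct (Set.univ : Set G)

namespace HasCyclicTransversal

variable {G Q : Type*} [Group G] [Group Q] {H K L : Subgroup G}

protected theorem refl (H : Subgroup G) : HasCyclicTransversal H H :=
  ⟨{1}, .one, by simp, fun g hg => ⟨1, by simpa using hg, by simp⟩⟩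

protected theorem trans (hHK : H ≤ K) (hLH : HasCyclicTransversal L H)
    (hHK' : HasCyclicTransversal H K) (hL : L ≤ H) : HasCyclicTransversal L K := by
  obtain ⟨A, hA, hAK, hAu⟩ := hHK'
  obtain ⟨B, hB, hBH, hBu⟩ := hLH
  have key : ∀ x ∈ A, ∀ x' ∈ A, ∀ y ∈ H, ∀ y' ∈ H, x * y = x' * y' → x = x' := by
    intro x hx x' hx' y hy y' hy' h
    refine (hAu (x * y) (mul_mem (hAK hx) (hHK hy))).unique ⟨hx, by simpa using hy⟩ ⟨hx', ?_⟩
    rw [h]; simpa using hy'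
  refine ⟨_, hA.mul_set hB fun x hx x' hx' y hy y' hy' h => ?_, ?_, fun g hg => ?_⟩
  · obtain rfl := key x hx x' hx' y (hBH hy) y' (hBH hy') h
    exact ⟨rfl, mul_left_cancel h⟩
  · rintro _ ⟨x, hx, y, hy, rfl⟩
    exact mul_mem (hAK hx) (hHK (hBH hy))
  · obtain ⟨x, ⟨hx, hxg⟩, -⟩ := hAu g hg
    obtain ⟨y, ⟨hy, hyg⟩, hyu⟩ := hBu _ hxg
    refine ⟨x * y, ⟨⟨x, hx, y, hy, rfl⟩, by simpa [mul_assoc] using hyg⟩, ?_⟩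
    rintro _ ⟨⟨x', hx', y', hy', rfl⟩, h⟩
    have h' : y'⁻¹ * (x'⁻¹ * g) ∈ L := by simpa [mul_assoc] using h
    have h2 : x'⁻¹ * g ∈ H := by
      have := mul_mem (hBH hy') (hL h')
      simpa using this
    obtain rfl := key x hx x' hx' _ hxg _ h2 (by simp)
    rw [hyu y' ⟨hy', h'⟩]

theorem of_two (a b : G) (m k : ℕ) (ha : a ∈ K) (hb : b ∈ K)
    (hex : ∀ g ∈ K, ∃ i ≤ m, ∃ j ≤ k, (a ^ i * b ^ j)⁻¹ * g ∈ H)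
    (hun : ∀ i ≤ m, ∀ j ≤ k, ∀ i' ≤ m, ∀ j' ≤ k, (a ^ i * b ^ j)⁻¹ * (a ^ i' * b ^ j') ∈ H →
      i = i' ∧ j = j') : HasCyclicTransversal H K := by
  have hun' : ∀ i ≤ m, ∀ j ≤ k, ∀ i' ≤ m, ∀ j' ≤ k, a ^ i * b ^ j = a ^ i' * b ^ j' →
      i = i' ∧ j = j' := fun i hi j hj i' hi' j' hj' h =>
    hun i hi j hj i' hi' j' hj' (by rw [h]; simp)
  have hB : IsCyclicProduct {g | ∃ j ≤ k, g = b ^ j} := .powers b k fun j hj j' hj' h =>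
    (hun' 0 (Nat.zero_le _) j hj 0 (Nat.zero_le _) j' hj' (by simpa using h)).2
  refine ⟨_, .mul a m hB ?_, ?_, fun g hg => ?_⟩
  · rintro i hi i' hi' _ ⟨j, hj, rfl⟩ _ ⟨j', hj', rfl⟩ h
    obtain ⟨h1, rfl⟩ := hun' i hi j hj i' hi' j' hj' h
    exact ⟨h1, rfl⟩
  · rintro _ ⟨i, hi, _, ⟨j, hj, rfl⟩, rfl⟩
    exact mul_mem (pow_mem ha _) (pow_mem hb _)
  · obtain ⟨i, hi, j, hj, h⟩ := hex g hg
    refine ⟨a ^ i * b ^ j, ⟨⟨i, hi, _, ⟨j, hj, rfl⟩, rfl⟩, h⟩, ?_⟩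
    rintro _ ⟨⟨i', hi', _, ⟨j', hj', rfl⟩, rfl⟩, h'⟩
    obtain ⟨rfl, rfl⟩ := hun i hi j hj i' hi' j' hj' (by
      have := mul_mem h (inv_mem h')
      simpa [mul_assoc] using this)
    rfl

theorem of_surjective {f : K →* Q} (hf : Function.Surjective f) (hQ : IsCyclicallyFactored Q)
    (hker : ∀ k : K, f k = 1 ↔ (k : G) ∈ H) : HasCyclicTransversal H K := by
  obtain ⟨B, hB, -, hu⟩ := hQ.exists_lift hf
  refine ⟨K.subtype '' B, hB.image K.subtype_injective.injOn, ?_, fun g hg => ?_⟩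
  · rintro _ ⟨x, -, rfl⟩
    exact x.2
  · obtain ⟨b, ⟨hb, hbg⟩, hbu⟩ := hu (f ⟨g, hg⟩) trivial
    refine ⟨b, ⟨⟨b, hb, rfl⟩, (hker (b⁻¹ * ⟨g, hg⟩)).1 (by simp [hbg])⟩, ?_⟩
    rintro _ ⟨⟨c, hc, rfl⟩, h⟩
    have h2 : f (c⁻¹ * ⟨g, hg⟩) = 1 := (hker _).2 h
    rw [hbu c ⟨hc, by simpa [inv_mul_eq_one] using h2⟩]
    rfl

theorem isCyclicallyFactored_coe (h : HasCyclicTransversal ⊥ K) : IsCyclicallyFactored K := by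
  obtain ⟨A, hA, hAK, h⟩ := h
  refine (congrArg IsCyclicProduct (Set.eq_univ_of_forall fun g => ?_)).mp
    (hA.preimage_subtype hAK)
  obtain ⟨a, ⟨ha, hg⟩, -⟩ := h g g.2
  rw [Subgroup.mem_bot, inv_mul_eq_one] at hg
  rw [Set.mem_preimage, Subgroup.subtype_apply, ← hg]
  exact ha

theorem isCyclicallyFactored (h : HasCyclicTransversal (⊥ : Subgroup G) ⊤) :
    IsCyclicallyFactored G := by
  obtain ⟨A, hA, -, h⟩ := h
  refine (congrArg IsCyclicProduct (Set.eq_univ_of_forall fun g => ?_)).mp hA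
  obtain ⟨a, ⟨ha, hg⟩, -⟩ := h g trivial
  rw [Subgroup.mem_bot, inv_mul_eq_one] at hg
  exact hg ▸ ha

theorem isCyclicallyFactored_quotient [H.Normal] (h : HasCyclicTransversal H ⊤) :
    IsCyclicallyFactored (G ⧸ H) := by
  obtain ⟨A, hA, -, h⟩ := h
  have := hA.image (f := QuotientGroup.mk' H) fun x hx y hy hxy =>
    (h y trivial).unique ⟨hx, QuotientGroup.eq.1 hxy⟩ ⟨hy, by simp⟩
  refine (congrArg IsCyclicProduct (Set.eq_univ_of_forall fun q => ?_)).mp this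
  obtain ⟨g, rfl⟩ := QuotientGroup.mk'_surjective H q
  obtain ⟨a, ⟨ha, hg⟩, -⟩ := h g trivial
  exact ⟨a, ha, QuotientGroup.eq.2 hg⟩

end HasCyclicTransversal

namespace IsCyclicallyFactored

variable {G Q : Type*} [Group G] [Group Q]

theorem of_mulEquiv (e : G ≃* Q) (h : IsCyclicallyFactored G) : IsCyclicallyFactored Q := by
  have := IsCyclicProduct.image (f := e.toMonoidHom) h e.injective.injOn
  rwa [Set.image_univ, MulEquiv.toMonoidHom_eq_coe, MonoidHom.coe_coe, e.surjective.range_eq] at this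

theorem of_subsingleton [Subsingleton G] : IsCyclicallyFactored G := by
  rw [IsCyclicallyFactored, ← Set.Nonempty.eq_univ (Set.singleton_nonempty (1 : G))]
  exact .one

theorem of_isCyclic [Finite G] [IsCyclic G] : IsCyclicallyFactored G := by
  obtain ⟨a, ha⟩ := IsCyclic.exists_generator (α := G)
  have hpos := orderOf_pos a
  refine (congrArg IsCyclicProduct (Set.eq_univ_of_forall fun g => ?_)).mp
    (IsCyclicProduct.powers a (orderOf a - 1) fun i hi j hj h =>
      pow_injOn_Iio_orderOf (Set.mem_Iio.2 (by omega)) (Set.mem_Iio.2 (by omega)) h)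
  obtain ⟨k, rfl⟩ := (mem_powers_iff_mem_zpowers.2 (ha g) : g ∈ Submonoid.powers a)
  exact ⟨k % orderOf a, by have := Nat.mod_lt k hpos; omega, (pow_mod_orderOf a k).symm⟩

/-- Induction on the order: the quotient by a nontrivial cyclic subgroup is smaller, and its
factorization lifts to a transversal of that subgroup. -/
theorem of_commGroup (G : Type*) [CommGroup G] [Finite G] : IsCyclicallyFactored G := by
  induction hn : Nat.card G using Nat.strong_induction_on generalizing G with
  | _ n ih =>
    subst hn
    rcases subsingleton_or_nontrivial G with h | h
    · exact of_subsingleton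
    · obtain ⟨a, ha⟩ := exists_ne (1 : G)
      have hlt : Nat.card (G ⧸ Subgroup.zpowers a) < Nat.card G := by
        rw [Subgroup.card_eq_card_quotient_mul_card_subgroup (Subgroup.zpowers a)]
        have h1 : 1 < Nat.card (Subgroup.zpowers a) := by
          rw [Subgroup.one_lt_card_iff_ne_bot]
          simpa using ha
        exact lt_mul_of_one_lt_right Nat.card_pos h1
      have hq := ih _ hlt _ rfl
      refine (HasCyclicTransversal.trans le_top
        (.of_surjective (f := MonoidHom.id _) (H := ⊥) (K := Subgroup.zpowers a)
          Function.surjective_id of_isCyclic (by simp))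
        (.of_surjective (f := (QuotientGroup.mk' (Subgroup.zpowers a)).comp
          (Subgroup.subtype ⊤)) ?_ hq ?_) bot_le).isCyclicallyFactored
      · intro q
        obtain ⟨g, rfl⟩ := QuotientGroup.mk'_surjective _ q
        exact ⟨⟨g, trivial⟩, rfl⟩
      · intro k
        simp

end IsCyclicallyFactored

namespace HasCyclicTransversal

variable {G Q : Type*} [Group G] {H K : Subgroup G}

theorem of_commGroup [CommGroup Q] [Finite Q] (f : K →* Q)
    (hker : ∀ k : K, f k = 1 ↔ (k : G) ∈ H) : HasCyclicTransversal H K :=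
  of_surjective f.rangeRestrict_surjective (IsCyclicallyFactored.of_commGroup f.range)
    (by simpa [Subtype.ext_iff] using hker)

theorem of_isCyclicallyFactored (h : IsCyclicallyFactored K) : HasCyclicTransversal ⊥ K :=
  of_surjective (f := MonoidHom.id K) Function.surjective_id h (by simp)

end HasCyclicTransversal

/-- Descending the series, a lifted factorization of each factor extends the transversal of one term
in `G` to the next term. -/
theorem GroupCompositionSeries.isCyclicallyFactored {G : Type*} [Group G]
    (s : GroupCompositionSeries G) (hs : ∀ i : Fin s.length, IsCyclicallyFactored (s.Factor i)) :
    IsCyclicallyFactored G := by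
  suffices h : ∀ j : Fin (s.length + 1), HasCyclicTransversal (s.term j) ⊤ by
    have := h (Fin.last _)
    rw [s.term_last] at this
    exact this.isCyclicallyFactored
  intro j
  induction j using Fin.induction with
  | zero => rw [s.term_zero]; exact .refl _
  | succ i ih =>
    refine .trans le_top (.of_surjective (f := QuotientGroup.mk' _)
      (QuotientGroup.mk'_surjective _) (hs i) fun k => ?_) ih (s.le i)
    rw [QuotientGroup.mk'_apply, QuotientGroup.eq_one_iff, Subgroup.mem_subgroupOf]

/-! ### Alternating groups -/

open Equiv Perm in
theorem Equiv.Perm.IsCycleOn.sign_eq {α : Type*} [Fintype α] [DecidableEq α] {s : Finset α}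
    (hs : s.Nonempty) {f : Perm α} (hf : f.IsCycleOn s) (hsupp : f.support ⊆ s) :
    sign f = -(-1) ^ s.card := by
  obtain ⟨a, rfl⟩ | hnt := hs.exists_eq_singleton_or_nontrivial
  · have : f = 1 := by
      rw [← Perm.support_eq_empty_iff]
      refine Finset.eq_empty_of_forall_notMem fun x hx => ?_
      obtain rfl := Finset.mem_singleton.1 (hsupp hx)
      exact Perm.mem_support.1 hx (by simpa using hf)
    simp [this]
  · have hcyc : f.IsCycle := isCycle_iff_exists_isCycleOn.2
      ⟨s, hnt, hf, fun x hx => hsupp (Perm.mem_support.2 hx)⟩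
    have : f.support = s := hsupp.antisymm fun x hx => Perm.mem_support.2 (hf.apply_ne hnt hx)
    rw [hcyc.sign, this]

/-- The subgroup of even permutations supported in the finite set `s`. -/
def evenPermOn {α : Type*} [Fintype α] [DecidableEq α] (s : Finset α) : Subgroup (Equiv.Perm α) where
  carrier := {f | Equiv.Perm.sign f = 1 ∧ ∀ x ∉ s, f x = x}
  one_mem' := by simp
  mul_mem' := by
    rintro f g ⟨hf, hf'⟩ ⟨hg, hg'⟩
    exact ⟨by simp [hf, hg], fun x hx => by simp [hg' x hx, hf' x hx]⟩
  inv_mem' := by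
    rintro f ⟨hf, hf'⟩
    exact ⟨by simp [hf], fun x hx => by rw [Equiv.Perm.inv_eq_iff_eq, hf' x hx]⟩

namespace evenPermOn

open Equiv Equiv.Perm

variable {α : Type*} [Fintype α] [DecidableEq α] {s : Finset α}

theorem mem_iff {f : Perm α} : f ∈ evenPermOn s ↔ sign f = 1 ∧ ∀ x ∉ s, f x = x := Iff.rfl

theorem apply_mem {f : Perm α} (hf : f ∈ evenPermOn s) {x : α} (hx : x ∈ s) : f x ∈ s := by
  by_contra h
  have := f.injective (hf.2 _ h)
  rw [this] at h
  exact h hx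

theorem mem_erase_iff {f : Perm α} {a : α} (ha : a ∈ s) :
    f ∈ evenPermOn (s.erase a) ↔ f ∈ evenPermOn s ∧ f a = a := by
  simp only [mem_iff, Finset.mem_erase, not_and_or, not_not]
  constructor
  · exact fun ⟨h, h'⟩ => ⟨⟨h, fun x hx => h' x (.inr hx)⟩, h' a (.inl rfl)⟩
  · rintro ⟨⟨h, h'⟩, h''⟩
    refine ⟨h, ?_⟩
    rintro x (rfl | hx)
    exacts [h'', h' x hx]

theorem eq_bot_of_card_le_two (hs : s.card ≤ 2) : evenPermOn s = ⊥ := by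
  refine (Subgroup.eq_bot_iff_forall _).2 fun f hf => ?_
  by_contra hne
  have hsub : f.support ⊆ s := fun x hx => by
    by_contra h
    exact Perm.mem_support.1 hx (hf.2 x h)
  have h2 := two_le_card_support_of_ne_one hne
  have h3 := Finset.card_le_card hsub
  have h4 : f.support.card = 2 := by omega
  have := (card_support_eq_two.1 h4).sign_eq
  rw [hf.1] at this
  exact absurd this (by decide)

/-- A left coset of the stabilizer of `a` is determined by the image of `a`, so the representatives
need only carry `a` to each point of `s` once. -/
theorem hasCyclicTransversal_erase {a : α} (ha : a ∈ s) (c b : Perm α) (m k : ℕ)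
    (hc : c ∈ evenPermOn s) (hb : b ∈ evenPermOn s)
    (hex : ∀ x ∈ s, ∃ i ≤ m, ∃ j ≤ k, (c ^ i) ((b ^ j) a) = x)
    (hun : ∀ i ≤ m, ∀ j ≤ k, ∀ i' ≤ m, ∀ j' ≤ k, (c ^ i) ((b ^ j) a) = (c ^ i') ((b ^ j') a) →
      i = i' ∧ j = j') : HasCyclicTransversal (evenPermOn (s.erase a)) (evenPermOn s) := by
  have key : ∀ t ∈ evenPermOn s, ∀ g ∈ evenPermOn s,
      (t⁻¹ * g ∈ evenPermOn (s.erase a) ↔ t a = g a) := by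
    intro t ht g hg
    rw [mem_erase_iff ha, and_iff_right (mul_mem (inv_mem ht) hg), Perm.mul_apply,
      Perm.inv_eq_iff_eq, eq_comm]
  have hm : ∀ i j : ℕ, c ^ i * b ^ j ∈ evenPermOn s := fun i j =>
    mul_mem (pow_mem hc i) (pow_mem hb j)
  refine .of_two c b m k hc hb (fun g hg => ?_) fun i hi j hj i' hi' j' hj' h =>
    hun i hi j hj i' hi' j' hj' ((key _ (hm i j) _ (hm i' j')).1 h)
  obtain ⟨i, hi, j, hj, h⟩ := hex (g a) (apply_mem hg ha)
  exact ⟨i, hi, j, hj, (key _ (hm i j) _ hg).2 h⟩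

/-- A full cycle on an odd number of points is even, and its powers suffice. -/
theorem hasCyclicTransversal_erase_of_odd {a : α} (ha : a ∈ s) (hs : Odd s.card) :
    HasCyclicTransversal (evenPermOn (s.erase a)) (evenPermOn s) := by
  obtain ⟨c, hc, hsupp⟩ := s.exists_cycleOn
  have hcs : c ∈ evenPermOn s := by
    refine ⟨by rw [hc.sign_eq ⟨a, ha⟩ hsupp, hs.neg_one_pow, neg_neg], fun x hx => ?_⟩
    by_contra h
    exact hx (hsupp (Perm.mem_support.2 h))
  have hpos : 0 < s.card := Finset.card_pos.2 ⟨a, ha⟩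
  refine hasCyclicTransversal_erase ha c 1 (s.card - 1) 0 hcs (one_mem _) (fun x hx => ?_) ?_
  · obtain ⟨i, hi, h⟩ := hc.exists_pow_eq ha hx
    exact ⟨i, by omega, 0, le_rfl, by simpa using h⟩
  · intro i hi j hj i' hi' j' hj' h
    refine ⟨?_, by omega⟩
    have : (c ^ i) a = (c ^ i') a := by simpa using h
    exact ((hc.pow_apply_eq_pow_apply ha).1 this).eq_of_lt_of_lt (by omega) (by omega)

/-- A full cycle is now odd. Two cycles of equal length on the two halves of `s` have an even
product, whose powers sweep the half of `a`; an even permutation `b` moving `a` across first gives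
the other half. -/
theorem hasCyclicTransversal_erase_of_even (hs : Even s.card) (hs' : 2 < s.card) :
    ∃ a ∈ s, HasCyclicTransversal (evenPermOn (s.erase a)) (evenPermOn s) := by
  obtain ⟨n, hn⟩ := hs
  obtain ⟨s₁, hs₁, hcard₁⟩ := Finset.exists_subset_card_eq (show n ≤ s.card by omega)
  set s₂ := s \ s₁ with hs₂
  have hcard₂ : s₂.card = n := by rw [Finset.card_sdiff_of_subset hs₁]; omega
  have hdisj : Disjoint s₁ s₂ := Finset.disjoint_sdiff
  have hs₂' : s₂ ⊆ s := Finset.sdiff_subset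
  obtain ⟨a, ha⟩ := Finset.card_pos.1 (show 0 < s₁.card by omega)
  obtain ⟨e, he⟩ := Finset.card_pos.1 (show 0 < s₂.card by omega)
  have hae : a ≠ e := fun h => Finset.disjoint_left.1 hdisj ha (h ▸ he)
  obtain ⟨d, hd, hda, hde⟩ : ∃ d ∈ s, d ≠ a ∧ d ≠ e := by
    by_contra! h
    have : s ⊆ {a, e} := fun x hx => by
      by_cases hxa : x = a
      · simp [hxa]
      · simp [h x hx hxa]
    have := (Finset.card_le_card this).trans Finset.card_le_two
    omega
  obtain ⟨c₁, hc₁, hsupp₁⟩ := s₁.exists_cycleOn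
  obtain ⟨c₂, hc₂, hsupp₂⟩ := s₂.exists_cycleOn
  have hfix₁ : ∀ x ∉ s₁, c₁ x = x := fun x hx => by
    by_contra h
    exact hx (hsupp₁ (Perm.mem_support.2 h))
  have hfix₂ : ∀ x ∉ s₂, c₂ x = x := fun x hx => by
    by_contra h
    exact hx (hsupp₂ (Perm.mem_support.2 h))
  have hcomm : Commute c₁ c₂ := by
    refine Perm.Disjoint.commute fun x => ?_
    by_cases hx : x ∈ s₁
    · exact .inr (hfix₂ x (Finset.disjoint_left.1 hdisj hx))
    · exact .inl (hfix₁ x hx)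
  have hpow₁ : ∀ i, ∀ x ∈ s₁, ((c₁ * c₂) ^ i) x = (c₁ ^ i) x := fun i x hx => by
    rw [hcomm.mul_pow, Perm.mul_apply, Perm.pow_apply_eq_self_of_apply_eq_self
      (hfix₂ x (Finset.disjoint_left.1 hdisj hx))]
  have hpow₂ : ∀ i, ∀ x ∈ s₂, ((c₁ * c₂) ^ i) x = (c₂ ^ i) x := fun i x hx => by
    rw [hcomm.eq, hcomm.symm.mul_pow, Perm.mul_apply, Perm.pow_apply_eq_self_of_apply_eq_self
      (hfix₁ x (Finset.disjoint_right.1 hdisj hx))]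
  have hmem₁ : ∀ i, ∀ x ∈ s₁, ((c₁ * c₂) ^ i) x ∈ s₁ := fun i x hx => by
    rw [hpow₁ i x hx]
    exact hc₁.1.mapsTo.perm_pow i hx
  have hmem₂ : ∀ i, ∀ x ∈ s₂, ((c₁ * c₂) ^ i) x ∈ s₂ := fun i x hx => by
    rw [hpow₂ i x hx]
    exact hc₂.1.mapsTo.perm_pow i hx
  -- The third point `d` serves only to make `b` even; it exists because `s` has more than two
  -- points.
  set b := swap a e * swap e d with hb
  have hba : b a = e := by
    rw [hb, Perm.mul_apply, swap_apply_of_ne_of_ne hae hda.symm, swap_apply_left]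
  refine ⟨a, hs₁ ha, hasCyclicTransversal_erase (hs₁ ha) (c₁ * c₂) b (n - 1) 1 ⟨?_, ?_⟩ ⟨?_, ?_⟩
    (fun x hx => ?_) ?_⟩
  · rw [Perm.sign_mul, hc₁.sign_eq ⟨a, ha⟩ hsupp₁, hc₂.sign_eq ⟨e, he⟩ hsupp₂, hcard₁, hcard₂]
    exact Int.units_mul_self _
  · intro x hx
    rw [Perm.mul_apply, hfix₂ x fun h => hx (hs₂' h), hfix₁ x fun h => hx (hs₁ h)]
  · rw [Perm.sign_mul, sign_swap hae, sign_swap hde.symm]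
    rfl
  · intro x hx
    have h1 : x ≠ a := fun h => hx (h ▸ hs₁ ha)
    have h2 : x ≠ e := fun h => hx (h ▸ hs₂' he)
    have h3 : x ≠ d := fun h => hx (h ▸ hd)
    rw [Perm.mul_apply, swap_apply_of_ne_of_ne h2 h3, swap_apply_of_ne_of_ne h1 h2]
  · by_cases hx₁ : x ∈ s₁
    · obtain ⟨i, hi, h⟩ := hc₁.exists_pow_eq ha hx₁
      exact ⟨i, by omega, 0, by omega, by rw [pow_zero, Perm.one_apply, hpow₁ i a ha, h]⟩
    · obtain ⟨i, hi, h⟩ := hc₂.exists_pow_eq he (Finset.mem_sdiff.2 ⟨hx, hx₁⟩)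
      exact ⟨i, by omega, 1, le_rfl, by rw [pow_one, hba, hpow₂ i e he, h]⟩
  · intro i hi j hj i' hi' j' hj' h
    have hj : j = 0 ∨ j = 1 := by omega
    have hj' : j' = 0 ∨ j' = 1 := by omega
    rcases hj with rfl | rfl <;> rcases hj' with rfl | rfl <;>
      simp only [pow_zero, pow_one, Perm.one_apply, hba] at h
    · rw [hpow₁ i a ha, hpow₁ i' a ha, hc₁.pow_apply_eq_pow_apply ha, hcard₁] at h
      exact ⟨h.eq_of_lt_of_lt (by omega) (by omega), rfl⟩
    · exact absurd (hmem₂ i' e he) (h ▸ Finset.disjoint_left.1 hdisj (hmem₁ i a ha))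
    · exact absurd (hmem₂ i e he) (h ▸ Finset.disjoint_left.1 hdisj (hmem₁ i' a ha))
    · rw [hpow₂ i e he, hpow₂ i' e he, hc₂.pow_apply_eq_pow_apply he, hcard₂] at h
      exact ⟨h.eq_of_lt_of_lt (by omega) (by omega), rfl⟩

theorem hasCyclicTransversal_bot (s : Finset α) : HasCyclicTransversal ⊥ (evenPermOn s) := by
  induction hn : s.card using Nat.strong_induction_on generalizing s with
  | _ n ih =>
    subst hn
    rcases Nat.lt_or_ge 2 s.card with h | h
    · obtain ⟨a, ha, hT⟩ :
          ∃ a ∈ s, HasCyclicTransversal (evenPermOn (s.erase a)) (evenPermOn s) := by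
        rcases Nat.even_or_odd s.card with he | ho
        · exact hasCyclicTransversal_erase_of_even he h
        · obtain ⟨a, ha⟩ := Finset.card_pos.1 (show 0 < s.card by omega)
          exact ⟨a, ha, hasCyclicTransversal_erase_of_odd ha ho⟩
      exact .trans (fun f hf => ((mem_erase_iff ha).1 hf).1)
        (ih _ (Finset.card_erase_lt_of_mem ha) _ rfl) hT bot_le
    · rw [eq_bot_of_card_le_two h]
      exact .refl _

end evenPermOn

theorem IsCyclicallyFactored.alternatingGroup (α : Type*) [Fintype α] [DecidableEq α] :
    IsCyclicallyFactored (alternatingGroup α) := by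
  have h := evenPermOn.hasCyclicTransversal_bot (Finset.univ : Finset α)
  have he : evenPermOn (Finset.univ : Finset α) = _root_.alternatingGroup α := by
    ext f
    simp [evenPermOn.mem_iff, Equiv.Perm.mem_alternatingGroup]
  rw [he] at h
  exact h.isCyclicallyFactored_coe

/-! ### The stabilizer of a line in `SL_{m+1}(F)` -/

namespace Matrix.SpecialLinearGroup

variable {F : Type*} [Field F] {m : ℕ}

/-- The stabilizer of the line spanned by the first basis vector. -/
def lineStabilizer (F : Type*) [Field F] (m : ℕ) : Subgroup (SpecialLinearGroup (Fin (m + 1)) F) where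
  carrier := {A | ∀ i : Fin m, A i.succ 0 = 0}
  one_mem' i := by simp
  mul_mem' := by
    intro A B hA hB i
    have hA : ∀ i : Fin m, A i.succ 0 = 0 := hA
    have hB : ∀ i : Fin m, B i.succ 0 = 0 := hB
    simp [coe_mul, Matrix.mul_apply, Fin.sum_univ_succ, hA, hB]
  inv_mem' := by
    intro A hA i
    have hA : ∀ i : Fin m, A i.succ 0 = 0 := hA
    have h : ∀ j, (A⁻¹ * A) j 0 = A⁻¹ j 0 * A 0 0 := fun j => by
      rw [coe_mul, Matrix.mul_apply, Fin.sum_univ_succ]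
      simp [hA]
    have h0 := h 0
    have h1 := h i.succ
    rw [inv_mul_cancel, coe_one] at h0 h1
    rw [one_apply_eq] at h0
    rw [one_apply_ne (Fin.succ_ne_zero i)] at h1
    exact (mul_eq_zero.1 h1.symm).resolve_right (right_ne_zero_of_mul (h0 ▸ one_ne_zero))

theorem mem_lineStabilizer {A : SpecialLinearGroup (Fin (m + 1)) F} :
    A ∈ lineStabilizer F m ↔ ∀ i : Fin m, A i.succ 0 = 0 := Iff.rfl

theorem mul_apply_zero_of_mem {A B : SpecialLinearGroup (Fin (m + 1)) F}
    (hB : B ∈ lineStabilizer F m) (i : Fin (m + 1)) : (A * B) i 0 = A i 0 * B 0 0 := by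
  rw [coe_mul, Matrix.mul_apply, Fin.sum_univ_succ]
  simp [mem_lineStabilizer.1 hB]

theorem mul_apply_succ_of_mem {A B : SpecialLinearGroup (Fin (m + 1)) F}
    (hA : A ∈ lineStabilizer F m) (i : Fin m) (j : Fin (m + 1)) :
    (A * B) i.succ j = ∑ k : Fin m, A i.succ k.succ * B k.succ j := by
  rw [coe_mul, Matrix.mul_apply, Fin.sum_univ_succ]
  simp [mem_lineStabilizer.1 hA]

theorem apply_zero_mul_det {A : SpecialLinearGroup (Fin (m + 1)) F}
    (hA : A ∈ lineStabilizer F m) :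
    A 0 0 * (A.1.submatrix Fin.succ Fin.succ).det = 1 := by
  have h := A.2
  rw [det_succ_column_zero, Fin.sum_univ_succ] at h
  have h2 : ∀ i : Fin m, A.1 i.succ 0 = 0 := mem_lineStabilizer.1 hA
  simpa [h2, Fin.succAbove_zero] using h

theorem apply_zero_ne_zero {A : SpecialLinearGroup (Fin (m + 1)) F}
    (hA : A ∈ lineStabilizer F m) : A 0 0 ≠ 0 :=
  left_ne_zero_of_mul (apply_zero_mul_det hA ▸ one_ne_zero)

/-- The eigenvalue of an element of the stabilizer of the first coordinate line on this line. -/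
def lineEigenvalue (F : Type*) [Field F] (m : ℕ) : lineStabilizer F m →* Fˣ where
  toFun A := Units.mk0 (A.1 0 0) (apply_zero_ne_zero A.2)
  map_one' := by ext; simp
  map_mul' A B := by
    ext
    simpa using mul_apply_zero_of_mem B.2 0

/-- The subgroup of the stabilizer of the first coordinate line
acting on this line as a central element of the special linear group. -/
def centralLineStabilizer (F : Type*) [Field F] (m : ℕ) :
    Subgroup (SpecialLinearGroup (Fin (m + 1)) F) :=
  ((powMonoidHom (m + 1)).comp (lineEigenvalue F m)).ker.map (lineStabilizer F m).subtype

theorem mem_centralLineStabilizer {A : SpecialLinearGroup (Fin (m + 1)) F} :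
    A ∈ centralLineStabilizer F m ↔ A ∈ lineStabilizer F m ∧ A 0 0 ^ (m + 1) = 1 := by
  simp [centralLineStabilizer, MonoidHom.mem_ker, lineEigenvalue, Units.ext_iff,
    and_comm]

/-- The action modulo the first coordinate line, normalized to be trivial on central elements. -/
def normalizedBlock (F : Type*) [Field F] (m : ℕ) :
    centralLineStabilizer F m →* SpecialLinearGroup (Fin m) F where
  toFun A := ⟨(A.1 0 0)⁻¹ • A.1.1.submatrix Fin.succ Fin.succ, by
    obtain ⟨hA, hpow⟩ := mem_centralLineStabilizer.1 A.2
    -- The unscaled block has determinant `(A 0 0)⁻¹`, and scaling contributes `m` more such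
    -- factors; this is why the `(m + 1)`-th power of the eigenvalue has to be 1.
    rw [det_smul, Fintype.card_fin, eq_inv_of_mul_eq_one_right (apply_zero_mul_det hA),
      ← pow_succ, inv_pow, hpow, inv_one]⟩
  map_one' := by
    ext i j
    simp [Matrix.one_apply]
  map_mul' A B := by
    obtain ⟨hA, -⟩ := mem_centralLineStabilizer.1 A.2
    obtain ⟨hB, -⟩ := mem_centralLineStabilizer.1 B.2
    ext i j
    have h0 := mul_apply_zero_of_mem (A := A.1) hB 0
    have h1 := mul_apply_succ_of_mem (B := B.1) hA i j.succ
    simp only [coe_mul, Subgroup.coe_mul] at h0 h1 ⊢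
    simp only [smul_apply, submatrix_apply, h0, h1, smul_eq_mul, mul_inv, Finset.mul_sum]
    refine Finset.sum_congr rfl fun k _ => ?_
    simp only [smul_apply, submatrix_apply, smul_eq_mul]
    ring

theorem normalizedBlock_apply (A : centralLineStabilizer F m) (i j : Fin m) :
    normalizedBlock F m A i j = (A.1 0 0)⁻¹ * A.1 i.succ j.succ := rfl

theorem normalizedBlock_surjective : Function.Surjective (normalizedBlock F m) := by
  intro B
  let M : Matrix (Fin (m + 1)) (Fin (m + 1)) F := Matrix.of fun i j =>
    Fin.cases (Fin.cases 1 (fun _ => 0) j) (fun i' => Fin.cases 0 (fun j' => B i' j') j) i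
  have hM : M.det = 1 := by
    rw [det_succ_column_zero, Fin.sum_univ_succ]
    have : M.submatrix Fin.succ Fin.succ = B.1 := by ext i j; simp [M]
    simpa [M, Fin.succAbove_zero] using congrArg det this
  have hmem : (⟨M, hM⟩ : SpecialLinearGroup (Fin (m + 1)) F) ∈ centralLineStabilizer F m :=
    mem_centralLineStabilizer.2 ⟨fun i => by simp [M], by simp [M]⟩
  refine ⟨⟨_, hmem⟩, ?_⟩
  ext i j
  simp [normalizedBlock_apply, M]

/-- The product of the center and of the group of transvections along the first coordinate line. -/
def centralTransvections (F : Type*) [Field F] (m : ℕ) :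
    Subgroup (SpecialLinearGroup (Fin (m + 1)) F) :=
  (normalizedBlock F m).ker.map (centralLineStabilizer F m).subtype

theorem mem_centralTransvections {A : SpecialLinearGroup (Fin (m + 1)) F} :
    A ∈ centralTransvections F m ↔ A ∈ centralLineStabilizer F m ∧
      ∀ i j : Fin m, A i.succ j.succ = if i = j then A 0 0 else 0 := by
  have key : ∀ h : A ∈ centralLineStabilizer F m, normalizedBlock F m ⟨A, h⟩ = 1 ↔
      ∀ i j : Fin m, A i.succ j.succ = if i = j then A 0 0 else 0 := fun h => by
    have h0 := apply_zero_ne_zero (mem_centralLineStabilizer.1 h).1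
    rw [SpecialLinearGroup.ext_iff]
    refine forall₂_congr fun i j => ?_
    rw [normalizedBlock_apply, inv_mul_eq_iff_eq_mul₀ h0, coe_one, Matrix.one_apply]
    simp
  constructor
  · rintro ⟨B, hB, rfl⟩
    exact ⟨B.2, (key B.2).1 hB⟩
  · rintro ⟨h, h'⟩
    exact ⟨⟨A, h⟩, (key h).2 h', rfl⟩

/-- The translation part of a product of a central element and of a transvection. -/
def translationPart (F : Type*) [Field F] (m : ℕ) :
    centralTransvections F m →* Multiplicative (Fin m → F) where
  toFun A := Multiplicative.ofAdd fun j => (A.1 0 0)⁻¹ * A.1 0 j.succ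
  map_one' := by
    refine congrArg Multiplicative.ofAdd (funext fun j => ?_)
    simp [Matrix.one_apply_ne (Fin.succ_ne_zero j).symm]
  map_mul' A B := by
    obtain ⟨hA, -⟩ := mem_centralTransvections.1 A.2
    obtain ⟨hB, hB'⟩ := mem_centralTransvections.1 B.2
    have hA := (mem_centralLineStabilizer.1 hA).1
    have hB := (mem_centralLineStabilizer.1 hB).1
    refine congrArg Multiplicative.ofAdd (funext fun j => ?_)
    have h0 := mul_apply_zero_of_mem (A := A.1) hB 0
    have h1 : (A.1 * B.1) 0 j.succ = A.1 0 0 * B.1 0 j.succ + A.1 0 j.succ * B.1 0 0 := by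
      rw [coe_mul, Matrix.mul_apply, Fin.sum_univ_succ]
      simp [hB']
    rw [Subgroup.coe_mul, h0, h1]
    have hA0 := apply_zero_ne_zero hA
    have hB0 := apply_zero_ne_zero hB
    simp only [Pi.add_apply, toAdd_ofAdd]
    field_simp
    ring

/-- Elements here are a scalar times a transvection, so a vanishing translation part leaves a scalar
matrix of determinant 1. -/
theorem translationPart_eq_one_iff (A : centralTransvections F m) :
    translationPart F m A = 1 ↔
      (A : SpecialLinearGroup (Fin (m + 1)) F) ∈ Subgroup.center _ := by
  obtain ⟨A, hA⟩ := A
  obtain ⟨hA', hdiag⟩ := mem_centralTransvections.1 hA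
  obtain ⟨hstab, hpow⟩ := mem_centralLineStabilizer.1 hA'
  have h0 := apply_zero_ne_zero hstab
  have h1 : translationPart F m ⟨A, hA⟩ = 1 ↔ ∀ j : Fin m, A 0 j.succ = 0 := by
    rw [← ofAdd_zero]
    refine (Multiplicative.ofAdd.injective.eq_iff (a := fun j : Fin m => (A 0 0)⁻¹ * A 0 j.succ)).trans ?_
    rw [funext_iff]
    simp [h0]
  rw [h1, mem_center_iff]
  constructor
  · refine fun h => ⟨A 0 0, by simpa using hpow, ?_⟩
    ext i j
    rw [scalar_apply, diagonal_apply]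
    cases i using Fin.cases with
    | zero =>
      cases j using Fin.cases with
      | zero => simp
      | succ j => simp [h, (Fin.succ_ne_zero j).symm]
    | succ i =>
      cases j using Fin.cases with
      | zero => simp [mem_lineStabilizer.1 hstab]
      | succ j => simp [hdiag]
  · rintro ⟨r, -, hr⟩ j
    rw [← hr, scalar_apply, diagonal_apply_ne _ (Fin.succ_ne_zero j).symm]

theorem center_le_centralTransvections :
    Subgroup.center (SpecialLinearGroup (Fin (m + 1)) F) ≤ centralTransvections F m := by
  intro A hA
  obtain ⟨r, hr, hA⟩ := mem_center_iff.1 hA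
  rw [mem_centralTransvections, mem_centralLineStabilizer, mem_lineStabilizer, ← hA]
  refine ⟨⟨fun i => ?_, by simpa using hr⟩, fun i j => ?_⟩
  · simp
  · simp [diagonal_apply]

/-- Along the chain center, `centralTransvections`, `centralLineStabilizer`, `lineStabilizer`, the
successive quotients embed in `F^m`, are `SL_m(F)`, and embed in `Fˣ`. -/
theorem hasCyclicTransversal_center_lineStabilizer [Finite F]
    (h : IsCyclicallyFactored (SpecialLinearGroup (Fin m) F)) :
    HasCyclicTransversal (Subgroup.center _) (lineStabilizer F m) := by
  have hQP : centralLineStabilizer F m ≤ lineStabilizer F m := Subgroup.map_subtype_le _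
  have hRQ : centralTransvections F m ≤ centralLineStabilizer F m := Subgroup.map_subtype_le _
  have h₁ : HasCyclicTransversal (Subgroup.center _) (centralTransvections F m) :=
    .of_commGroup (translationPart F m) translationPart_eq_one_iff
  have h₂ : HasCyclicTransversal (centralTransvections F m) (centralLineStabilizer F m) :=
    .of_surjective normalizedBlock_surjective h fun k => by
      simp [centralTransvections, MonoidHom.mem_ker]
  have h₃ : HasCyclicTransversal (centralLineStabilizer F m) (lineStabilizer F m) :=
    .of_commGroup ((powMonoidHom (m + 1)).comp (lineEigenvalue F m)) fun k => by
      simp [centralLineStabilizer, MonoidHom.mem_ker]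
  exact .trans hQP (.trans hRQ h₁ h₂ center_le_centralTransvections) h₃
    (center_le_centralTransvections.trans hRQ)

end Matrix.SpecialLinearGroup

/-! ### Norms and a basis adapted to the lines of a field extension -/

/-- Greedy choice: the span of the first `i` vectors has `q ^ i` elements, with `q = |F|`, too few
to contain `X i`. -/
theorem exists_linearIndependent_of_lt_ncard {F V : Type*} [Field F] [Finite F] [AddCommGroup V]
    [Module F V] {k : ℕ} (X : Fin k → Set V) (hfin : ∀ i, (X i).Finite)
    (hX : ∀ i : Fin k, Nat.card F ^ (i : ℕ) < (X i).ncard) :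
    ∃ w : Fin k → V, LinearIndependent F w ∧ ∀ i, w i ∈ X i := by
  induction k with
  | zero => exact ⟨Fin.elim0, linearIndependent_empty_type, fun i => i.elim0⟩
  | succ k ih =>
    obtain ⟨w, hw, hwX⟩ := ih (fun i => X i.castSucc) (fun i => hfin _) fun i => hX i.castSucc
    have hcard : Nat.card (Submodule.span F (Set.range w)) = Nat.card F ^ k := by
      have : Module.Finite F (Submodule.span F (Set.range w)) :=
        Module.Finite.span_of_finite F (Set.finite_range w)
      rw [Module.natCard_eq_pow_finrank (K := F), finrank_span_eq_card hw, Fintype.card_fin]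
    have : Finite (Submodule.span F (Set.range w)) :=
      Nat.finite_of_card_ne_zero (by rw [hcard]; exact pow_ne_zero _ Nat.card_pos.ne')
    obtain ⟨x, hx, hxs⟩ : ∃ x ∈ X (Fin.last k), x ∉ Submodule.span F (Set.range w) := by
      by_contra! h
      have h1 := Set.ncard_le_ncard (t := (Submodule.span F (Set.range w) : Set V)) h
        (Set.toFinite _)
      have h2 := hX (Fin.last k)
      rw [← Nat.card_coe_set_eq _, ← Nat.card_coe_set_eq _] at *
      exact absurd (h2.trans_le h1) (by simp [hcard])
    refine ⟨Fin.snoc w x, linearIndependent_finSnoc.2 ⟨hw, hxs⟩, fun i => ?_⟩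
    cases i using Fin.lastCases with
    | last => simpa using hx
    | cast i => simpa using hwX i

section Norm

variable (F K : Type*) [Field F] [Field K] [Algebra F K]

/-- The norm of a field extension as a homomorphism of unit groups. -/
noncomputable def unitsNorm : Kˣ →* Fˣ := Units.map (Algebra.norm F)

/-- The units whose norm is a `d`-th power, where `d` is the degree of the extension. -/
noncomputable def powerNormUnits : Subgroup Kˣ :=
  (powMonoidHom (Module.finrank F K) : Fˣ →* Fˣ).range.comap (unitsNorm F K)

variable {F K}

theorem unitsNorm_map (c : Fˣ) :
    unitsNorm F K (Units.map (algebraMap F K).toMonoidHom c) = c ^ Module.finrank F K := by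
  ext
  exact Algebra.norm_algebraMap (S := K) (c : F)

theorem map_mem_powerNormUnits (c : Fˣ) :
    Units.map (algebraMap F K).toMonoidHom c ∈ powerNormUnits F K :=
  ⟨c, (unitsNorm_map c).symm⟩

theorem mem_powerNormUnits_of_norm {x : Kˣ} (hx : unitsNorm F K x = 1) :
    x ∈ powerNormUnits F K := by
  rw [powerNormUnits, Subgroup.mem_comap, hx]
  exact one_mem _

variable [Finite F]

/-- The index is at most that of the `d`-th powers in `Fˣ`, here `d` the degree, and `Fˣ` is cyclic.
Both divisors matter: `d` bounds the number of cosets, `|Fˣ|` bounds the size of the subgroup from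
below. -/
theorem powerNormUnits_index_dvd :
    (powerNormUnits F K).index ∣ (Nat.card Fˣ).gcd (Module.finrank F K) := by
  rw [powerNormUnits, Subgroup.index_comap, ← IsCyclic.index_powMonoidHom_range]
  exact Subgroup.relIndex_dvd_index_of_normal _ _

/-- As the index is at most `q - 1`, the order is at least `(q ^ (m + 1) - 1) / (q - 1)`, which
exceeds `q ^ m` when `m > 0`. -/
theorem pow_lt_card_powerNormUnits [Finite K] {m : ℕ} (hm : 0 < m)
    (hK : Module.finrank F K = m + 1) : Nat.card F ^ m < Nat.card (powerNormUnits F K) := by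
  have hq : 1 < Nat.card F := Finite.one_lt_card
  have h1 := (powerNormUnits F K).card_mul_index
  have hdvd := (powerNormUnits_index_dvd (F := F) (K := K)).trans (Nat.gcd_dvd_left _ _)
  have h2 := Nat.le_of_dvd Nat.card_pos hdvd
  rw [Nat.card_units] at h1 h2
  rw [Module.natCard_eq_pow_finrank (K := F) (V := K), hK] at h1
  have hqm : 1 < Nat.card F ^ m := Nat.one_lt_pow hm.ne' hq
  by_contra! h
  have h3 := Nat.mul_le_mul h h2
  rw [h1, Nat.mul_sub, pow_succ, mul_one] at h3
  have : Nat.card F ^ m ≤ Nat.card F ^ m * Nat.card F := Nat.le_mul_of_pos_right _ (by omega)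
  omega

/-- `H` is generated by `Fˣ` and the norm-one group. Thus a unit up to scalars is a coset of `H`,
represented by `b j` with `j < d`, together with a power of `s` modulo scalars. -/
theorem exists_basis_norm_factorization [Finite K] {m : ℕ} (hm : 0 < m)
    (hK : Module.finrank F K = m + 1) :
    ∃ (b : Module.Basis (Fin (m + 1)) F K) (s : Kˣ) (e d : ℕ), unitsNorm F K s = 1 ∧
      0 < e ∧ 0 < d ∧ d ≤ m + 1 ∧
      (∀ x : K, x ≠ 0 → ∃ i < e, ∃ j : Fin (m + 1), (j : ℕ) < d ∧
        ∃ c : F, x = c • ((s : K) ^ i * b j)) ∧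
      ∀ i < e, ∀ i' < e, ∀ j j' : Fin (m + 1), (j : ℕ) < d → (j' : ℕ) < d →
        ∀ c : F, (s : K) ^ i' * b j' = c • ((s : K) ^ i * b j) → i = i' ∧ j = j' := by
  set H := powerNormUnits F K with hH
  set E : Subgroup Kˣ := (Units.map (algebraMap F K).toMonoidHom).range with hE
  obtain ⟨⟨s, hs⟩, hgen⟩ := IsCyclic.exists_generator (α := (unitsNorm F K).ker)
  have hd : H.index ≤ m + 1 := by
    rw [← hK]
    exact Nat.le_of_dvd (by omega) (powerNormUnits_index_dvd.trans (Nat.gcd_dvd_right _ _))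
  have hd0 : 0 < H.index := Nat.pos_of_ne_zero Subgroup.index_ne_zero_of_finite
  let r : Fin H.index ≃ Kˣ ⧸ H := (Finite.equivFin (Kˣ ⧸ H)).symm
  -- The indices beyond the number of cosets only complete the basis; the default 1 is arbitrary.
  let g : Fin (m + 1) → Kˣ := fun j => if h : (j : ℕ) < H.index then (r ⟨j, h⟩).out else 1
  let X : Fin (m + 1) → Set K := fun j => Set.range fun h : H => ((g j * h : Kˣ) : K)
  have hX : ∀ j, (X j).ncard = Nat.card H := fun j => by
    rw [← Nat.card_coe_set_eq]
    refine Nat.card_range_of_injective fun h h' hh => ?_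
    exact Subtype.ext (mul_left_cancel (Units.ext hh))
  obtain ⟨w, hw, hwX⟩ := exists_linearIndependent_of_lt_ncard (F := F) X
    (fun j => Set.toFinite _) fun j => by
      rw [hX]
      exact (Nat.pow_le_pow_right Nat.card_pos (by omega)).trans_lt
        (pow_lt_card_powerNormUnits hm hK)
  have hu : ∀ j, ∃ u : Kˣ, (u : K) = w j ∧ ∀ h : (j : ℕ) < H.index,
      (QuotientGroup.mk u : Kˣ ⧸ H) = r ⟨j, h⟩ := by
    intro j
    obtain ⟨h, hh⟩ := hwX j
    refine ⟨_, hh, fun hj => ?_⟩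
    rw [QuotientGroup.mk_mul_of_mem _ h.2]
    simp [g, hj]
  choose u huw hur using hu
  let b := basisOfLinearIndependentOfCardEqFinrank hw (by simp [hK])
  have hb : ∀ j, b j = u j := fun j => by simp [b, huw]
  have hsH : s ∈ H := mem_powerNormUnits_of_norm hs
  have he0 : 0 < orderOf (QuotientGroup.mk s : Kˣ ⧸ E) := orderOf_pos _
  refine ⟨b, s, orderOf (QuotientGroup.mk s : Kˣ ⧸ E), H.index, hs, he0, hd0, hd, ?_, ?_⟩
  · intro x hx
    obtain ⟨x, rfl⟩ : ∃ y : Kˣ, (y : K) = x := ⟨Units.mk0 x hx, rfl⟩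
    obtain ⟨⟨j, hj⟩, hjx⟩ := r.surjective (QuotientGroup.mk x)
    have hj' : j < m + 1 := by omega
    rw [← hur ⟨j, hj'⟩ hj, QuotientGroup.eq] at hjx
    obtain ⟨c, hc⟩ := hjx
    -- The norm of `u⁻¹ * x` is `c ^ (m + 1)`, the norm of the scalar `c`; dividing by `c` leaves a
    -- power of `s`.
    have hker : ((u ⟨j, hj'⟩)⁻¹ * x) * (Units.map (algebraMap F K).toMonoidHom c)⁻¹ ∈
        (unitsNorm F K).ker := by
      rw [MonoidHom.mem_ker, map_mul, map_inv, unitsNorm_map, ← hc]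
      simp
    obtain ⟨k, hk⟩ := mem_powers_iff_mem_zpowers.2 (hgen ⟨_, hker⟩)
    have hk : s ^ k = ((u ⟨j, hj'⟩)⁻¹ * x) * (Units.map (algebraMap F K).toMonoidHom c)⁻¹ :=
      congrArg Subtype.val hk
    have hmod : (QuotientGroup.mk (s ^ (k % orderOf (QuotientGroup.mk s : Kˣ ⧸ E))) : Kˣ ⧸ E) =
        QuotientGroup.mk (s ^ k) := by
      rw [QuotientGroup.mk_pow, QuotientGroup.mk_pow, pow_mod_orderOf]
    obtain ⟨c', hc'⟩ := QuotientGroup.eq.1 hmod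
    refine ⟨_, Nat.mod_lt k he0, ⟨j, hj'⟩, hj, ((c' * c : Fˣ) : F), ?_⟩
    have hx : x = Units.map (algebraMap F K).toMonoidHom (c' * c) *
        (s ^ (k % orderOf (QuotientGroup.mk s : Kˣ ⧸ E)) * u ⟨j, hj'⟩) := by
      rw [map_mul, hc', hk]
      generalize s ^ (k % orderOf (QuotientGroup.mk s : Kˣ ⧸ E)) = t
      generalize Units.map (algebraMap F K).toMonoidHom c = c
      rw [mul_assoc t⁻¹, inv_mul_cancel_right, mul_mul_mul_comm, inv_mul_cancel, one_mul,
        inv_mul_cancel_comm]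
    rw [hb, Algebra.smul_def]
    exact congrArg Units.val hx
  · intro i hi i' hi' j j' hj hj' c h
    have hc : c ≠ 0 := by
      rintro rfl
      rw [zero_smul, hb] at h
      exact (s ^ i' * u j').ne_zero h
    obtain ⟨c, rfl⟩ : ∃ y : Fˣ, (y : F) = c := ⟨Units.mk0 c hc, rfl⟩
    have h : s ^ i' * u j' = Units.map (algebraMap F K).toMonoidHom c * (s ^ i * u j) := by
      rw [hb, hb, Algebra.smul_def] at h
      exact Units.ext (by simpa using h)
    -- Modulo `H` both `s` and the scalars vanish, which determines `j`; modulo `E` the power of `s`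
    -- remains.
    have hcH : Units.map (algebraMap F K).toMonoidHom c ∈ H := map_mem_powerNormUnits c
    have hjj : j = j' := by
      have h1 := congrArg (QuotientGroup.mk' H) h
      simp only [map_mul, map_pow, QuotientGroup.mk'_apply,
        (QuotientGroup.eq_one_iff s).2 hsH, one_pow, one_mul] at h1
      rw [(QuotientGroup.eq_one_iff (Units.map (algebraMap F K).toMonoidHom c)).2 hcH, one_mul,
        hur j' hj', hur j hj] at h1
      have := congrArg Fin.val (r.injective h1)
      exact Fin.ext this.symm
    subst hjj
    refine ⟨?_, rfl⟩
    rw [← mul_assoc, mul_left_inj] at h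
    have hcE : (QuotientGroup.mk (Units.map (algebraMap F K).toMonoidHom c) : Kˣ ⧸ E) = 1 :=
      (QuotientGroup.eq_one_iff _).2 ⟨c, rfl⟩
    have h2 := congrArg (QuotientGroup.mk : Kˣ → Kˣ ⧸ E) h
    rw [QuotientGroup.mk_mul, hcE, one_mul, QuotientGroup.mk_pow, QuotientGroup.mk_pow] at h2
    exact pow_injOn_Iio_orderOf (Set.mem_Iio.2 hi) (Set.mem_Iio.2 hi') h2.symm

end Norm

/-! ### Transitivity on lines and factorization of `SL` and `PSL` -/

namespace Matrix.SpecialLinearGroup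

variable {F : Type*} [Field F] {m : ℕ}

theorem exists_pow_apply_zero (F : Type*) [Field F] (m : ℕ) :
    ∃ B : SpecialLinearGroup (Fin (m + 1)) F, ∀ k : ℕ, ∀ hk : k < m + 1, ∀ i,
      (B ^ k) i 0 = if i = ⟨k, hk⟩ then 1 else 0 := by
  let σ : Equiv.Perm (Fin (m + 1)) := finRotate (m + 1)
  let ε : F := ((Equiv.Perm.sign σ⁻¹ : ℤ) : F)
  -- The sign correcting the determinant sits in the last column, which the first `m` steps from the
  -- first basis vector never use.
  let D : Fin (m + 1) → F := fun i => if i = Fin.last m then ε else 1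
  have hε : ε * ε = 1 := by
    rw [← Int.cast_mul, ← Units.val_mul, Int.units_mul_self]
    simp
  have hdet : (σ⁻¹.permMatrix F * diagonal D).det = 1 := by
    rw [det_mul, det_permutation, det_diagonal, Finset.prod_ite_eq', if_pos (Finset.mem_univ _)]
    exact hε
  let B : SpecialLinearGroup (Fin (m + 1)) F := ⟨_, hdet⟩
  have hB : B.1 = σ⁻¹.permMatrix F * diagonal D := rfl
  clear_value B
  refine ⟨B, fun k => ?_⟩
  induction k with
  | zero =>
    intro hk i
    rw [pow_zero, coe_one, Matrix.one_apply]
    rfl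
  | succ k ih =>
    intro hk i
    have h1 : σ⁻¹ i = ⟨k, Nat.lt_of_succ_lt hk⟩ ↔ i = ⟨k + 1, hk⟩ := by
      rw [Equiv.Perm.inv_eq_iff_eq]
      have : σ ⟨k, Nat.lt_of_succ_lt hk⟩ = ⟨k + 1, hk⟩ := finRotate_of_lt (Nat.lt_of_succ_lt_succ hk)
      rw [this]
    have h2 : (⟨k, Nat.lt_of_succ_lt hk⟩ : Fin (m + 1)) ≠ Fin.last m := by
      exact Fin.ne_of_lt (Nat.lt_of_succ_lt_succ hk)
    rw [pow_succ', coe_mul, hB, mul_assoc, Equiv.Perm.permMatrix, PEquiv.toMatrix_toPEquiv_mul,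
      submatrix_apply, diagonal_mul, id, ih (Nat.lt_of_succ_lt hk)]
    simp only [h1]
    split_ifs with h
    · rw [h1.2 h]
      simp [D, h2]
    · simp

theorem inv_mul_mem_lineStabilizer_iff {A B : SpecialLinearGroup (Fin (m + 1)) F} :
    A⁻¹ * B ∈ lineStabilizer F m ↔ ∃ c : F, ∀ i, B i 0 = c * A i 0 := by
  constructor
  · intro h
    refine ⟨(A⁻¹ * B) 0 0, fun i => ?_⟩
    have := mul_apply_zero_of_mem (A := A) h i
    rwa [mul_inv_cancel_left, mul_comm] at this
  · rintro ⟨c, hc⟩ i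
    have h1 : (A⁻¹ * B) i.succ 0 = c * (A⁻¹ * A) i.succ 0 := by
      simp only [coe_mul, Matrix.mul_apply, hc, Finset.mul_sum]
      exact Finset.sum_congr rfl fun k _ => by ring
    have h2 : (A⁻¹ * A) i.succ 0 = 0 := by
      rw [inv_mul_cancel, coe_one, one_apply_ne (Fin.succ_ne_zero i)]
    rw [h1, h2, mul_zero]

/-- Left cosets of the stabilizer are lines, that is, elements of `K` up to scalars. `S` is
multiplication by `s`, of determinant equal to its norm 1, and `B ^ j` yields `b j`, so `S ^ i * B ^
j` represents `s ^ i * b j`. -/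
theorem hasCyclicTransversal_lineStabilizer (F : Type*) [Field F] [Finite F] (m : ℕ) :
    HasCyclicTransversal (lineStabilizer F m) ⊤ := by
  rcases Nat.eq_zero_or_pos m with rfl | hm
  · rw [show lineStabilizer F 0 = ⊤ from eq_top_iff.2 fun A _ i => i.elim0]
    exact .refl _
  obtain ⟨p, hp⟩ := CharP.exists F
  have : Fact p.Prime := ⟨CharP.char_is_prime F p⟩
  let K := FiniteField.Extension F p (m + 1)
  obtain ⟨b, s, e, d, hs, he, hd, hdm, hex, hun⟩ :=
    exists_basis_norm_factorization (F := F) (K := K) hm (FiniteField.finrank_extension F p (m + 1))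
  obtain ⟨B, hB⟩ := exists_pow_apply_zero F m
  let S : SpecialLinearGroup (Fin (m + 1)) F := ⟨Algebra.leftMulMatrix b (s : K), by
    rw [← Algebra.norm_eq_matrix_det]
    exact congrArg Units.val hs⟩
  -- The image of the first basis vector, read as an element of `K`.
  let φ : SpecialLinearGroup (Fin (m + 1)) F → K := fun A => b.equivFun.symm fun i => A i 0
  have hφ : ∀ A i, b.equivFun (φ A) i = A i 0 := fun A i =>
    congrFun (b.equivFun.apply_symm_apply fun i => A i 0) i
  have hφ0 : ∀ A, φ A ≠ 0 := fun A h => by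
    have h0 : A.1.det = 0 := det_eq_zero_of_column_eq_zero 0 fun i => by
      have := hφ A i
      rw [h, map_zero] at this
      exact this.symm
    exact one_ne_zero (A.2.symm.trans h0)
  have hline : ∀ A C : SpecialLinearGroup (Fin (m + 1)) F,
      A⁻¹ * C ∈ lineStabilizer F m ↔ ∃ c : F, φ C = c • φ A := fun A C => by
    rw [inv_mul_mem_lineStabilizer_iff]
    refine exists_congr fun c => ?_
    rw [← b.equivFun.injective.eq_iff, funext_iff]
    refine forall_congr' fun i => ?_
    rw [map_smul, Pi.smul_apply, hφ, hφ, smul_eq_mul]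
  have hφS : ∀ A, φ (S * A) = s * φ A := fun A => by
    apply b.equivFun.injective
    ext i
    have h := congrFun (Algebra.leftMulMatrix_mulVec_repr b (s : K) (φ A)) i
    rw [hφ, Module.Basis.equivFun_apply, ← h, coe_mul, Matrix.mul_apply]
    refine Finset.sum_congr rfl fun k _ => ?_
    rw [← hφ A k, Module.Basis.equivFun_apply]
  have hφSpow : ∀ (i : ℕ) A, φ (S ^ i * A) = (s : K) ^ i * φ A := fun i A => by
    induction i with
    | zero => simp
    | succ i ih => rw [pow_succ', mul_assoc, hφS, ih, pow_succ', mul_assoc]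
  have hφB : ∀ (j : ℕ) (hj : j < m + 1), φ (B ^ j) = b ⟨j, hj⟩ := fun j hj => by
    apply b.equivFun.injective
    ext i
    rw [hφ, hB j hj, Module.Basis.equivFun_apply, Module.Basis.repr_self, Finsupp.single_apply]
    simp [eq_comm]
  -- Exponent bounds are inclusive, hence `e - 1` and `d - 1`.
  refine .of_two S B (e - 1) (d - 1) trivial trivial (fun g _ => ?_) ?_
  · obtain ⟨i, hi, j, hj, c, hc⟩ := hex (φ g) (hφ0 g)
    refine ⟨i, by omega, j, by omega, (hline _ _).2 ⟨c, ?_⟩⟩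
    rw [hφSpow, hφB j j.2, hc]
  · intro i hi j hj i' hi' j' hj' h
    obtain ⟨c, hc⟩ := (hline _ _).1 h
    rw [hφSpow, hφSpow, hφB j (by omega), hφB j' (by omega)] at hc
    obtain ⟨h1, h2⟩ := hun i (by omega) i' (by omega) _ _ (show j < d by omega)
      (show j' < d by omega) c hc
    exact ⟨h1, congrArg Fin.val h2⟩

theorem hasCyclicTransversal_center [Finite F]
    (h : IsCyclicallyFactored (SpecialLinearGroup (Fin m) F)) :
    HasCyclicTransversal (Subgroup.center (SpecialLinearGroup (Fin (m + 1)) F)) ⊤ :=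
  .trans le_top (hasCyclicTransversal_center_lineStabilizer h)
    (hasCyclicTransversal_lineStabilizer F m)
    (center_le_centralTransvections.trans
      ((Subgroup.map_subtype_le _).trans (Subgroup.map_subtype_le _)))

/-- The induction runs through `SL` because the block quotient is all of `SL_m(F)`; the abelian
center is restored at each step. -/
theorem isCyclicallyFactored (F : Type*) [Field F] [Finite F] (n : ℕ) :
    IsCyclicallyFactored (SpecialLinearGroup (Fin n) F) := by
  induction n with
  | zero => exact .of_subsingleton
  | succ m ih =>
    let _ : CommGroup (Subgroup.center (SpecialLinearGroup (Fin (m + 1)) F)) :=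
      { (inferInstance : Group (Subgroup.center (SpecialLinearGroup (Fin (m + 1)) F))) with
        mul_comm := fun a b => Subtype.ext (Subgroup.mem_center_iff.1 b.2 a) }
    exact (HasCyclicTransversal.trans le_top
      (.of_isCyclicallyFactored (IsCyclicallyFactored.of_commGroup
        (Subgroup.center (SpecialLinearGroup (Fin (m + 1)) F))))
      (hasCyclicTransversal_center ih) bot_le).isCyclicallyFactored

theorem isCyclicallyFactored_quotient_center (F : Type*) [Field F] [Finite F] (n : ℕ) :
    IsCyclicallyFactored (ProjectiveSpecialLinearGroup (Fin n) F) := by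
  cases n with
  | zero => exact .of_subsingleton
  | succ m =>
    exact (hasCyclicTransversal_center (isCyclicallyFactored F m)).isCyclicallyFactored_quotient

end Matrix.SpecialLinearGroup

/-! ### Conclusion for all admissible composition factors -/

theorem IsCyclicOrAlternatingOrPSL.isCyclicallyFactored {S : Type*} [Group S] [Finite S]
    (h : IsCyclicOrAlternatingOrPSL S) : IsCyclicallyFactored S := by
  obtain h | ⟨n, ⟨e⟩⟩ | ⟨n, F, _, _, ⟨e⟩⟩ := h
  · exact .of_isCyclic
  · exact (IsCyclicallyFactored.alternatingGroup (Fin n)).of_mulEquiv e.symm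
  · exact (Matrix.SpecialLinearGroup.isCyclicallyFactored_quotient_center F n).of_mulEquiv e.symm

theorem theorem1 {G : Type*} [Group G] [Finite G] (s : GroupCompositionSeries G)
    (hs : ∀ i : Fin s.length, IsCyclicOrAlternatingOrPSL (s.Factor i)) :
    HasOrderedGeneratingSystem G :=
  IsCyclicProduct.hasOrderedGeneratingSystem
    (s.isCyclicallyFactored fun i => (hs i).isCyclicallyFactored)
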